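/- Let $G$ be an $\omega$-stable group, that is, a group which, possibly with further first-order structure, is a structure in a countable language $L$ in which the multiplication of $G$ is definable (for instance the language of groups), and whose complete theory is $\omega$-stable: for every $L$-structure $N$ elementarily equivalent to $G$ and every countable $A \subseteq N$ there are only countably many complete $1$-types over $A$ (relative to the theory of $N$ with names for the elements of $A$). Then every action of $G$ by automorphisms on a simplicial tree $T$ (a non-empty connected graph without circuits, in particular without loops and multiple edges) is trivial: no $g \in G$ is hyperbolic. In other words, every $g \in G$ either is elliptic, i.e. $gv = v$ for some vertex $v$ of $T$, or is an inversion, i.e. $g$ reverses some edge of $T$ (interchanges its two endpoints). -/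

import Mathlib

open FirstOrder

universe u v w x

/-- An `L`-structure `M` is `ω`-stable (that is, its complete theory is): over every countable set
`A` of parameters in a structure `N` elementarily equivalent to `M`, there are only countably many
complete `1`-types. Here `L[[A]].completeTheory N` is the set of all sentences with parameters from
`A` that are true in `N`. -/
def FirstOrder.Language.IsOmegaStable (L : Language.{u, v}) (M : Type w) [L.Structure M] : Prop :=
  ∀ (N : Type w) [L.Structure N], L.ElementarilyEquivalent M N →
    ∀ A : Set N, A.Countable →
      Countable ((L[[A]].completeTheory N).CompleteType (Fin 1))

namespace SimpleGraph

variable {V : Type x} {T : SimpleGraph V}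

/-- An automorphism is an inversion if it reverses some edge. -/
def IsInversion (f : T ≃g T) : Prop := ∃ a b : V, T.Adj a b ∧ f a = b ∧ f b = a

/-- An automorphism is elliptic if it fixes some vertex. -/
def IsElliptic (f : T ≃g T) : Prop := ∃ a : V, f a = a

/-- An automorphism is hyperbolic if it is neither an inversion nor elliptic. -/
def IsHyperbolic (f : T ≃g T) : Prop := ¬ IsInversion f ∧ ¬ IsElliptic f

/-- An action of a group by graph automorphisms is trivial if no element of the group is
hyperbolic. -/
def IsTrivialAction {G : Type w} [Group G] (ρ : G →* (T ≃g T)) : Prop :=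
  ∀ g : G, ¬ IsHyperbolic (ρ g)

end SimpleGraph

/-! Divisibility on the group side contradicts growth on the tree side. By the descending chain
condition on definable subgroups, some positive power of `g` has roots of all orders
(`exists_forall_isRoot`). A hyperbolic automorphism moves a vertex by an amount growing linearly in
the exponent, at rate at least 1, so a high-order root of a fixed power would move a vertex too far;
a non-hyperbolic root would have bounded orbits (`exists_not_isRoot`). -/

namespace SimpleGraph

variable {V : Type x} {T : SimpleGraph V}

/-! ### Displacement under tree automorphisms -/

theorem Iso.dist_apply (hT : T.Connected) (f : T ≃g T) (a b : V) :
    T.dist (f a) (f b) = T.dist a b := by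
  have key (e : T ≃g T) (a b : V) : T.dist (e a) (e b) ≤ T.dist a b := by
    obtain ⟨p, hp⟩ := hT.exists_walk_length_eq_dist a b
    have := dist_le (p.map e.toHom)
    rw [Walk.length_map, hp] at this
    exact this
  refine (key f a b).antisymm ?_
  simpa using key f.symm (f a) (f b)

theorem Walk.dist_getVert_le (hT : T.Connected) {u v : V} (p : T.Walk u v) (i j : ℕ) :
    T.dist (p.getVert i) (p.getVert (i + j)) ≤ j := by
  induction j with
  | zero => simp
  | succ j ih =>
    have h : T.dist (p.getVert (i + j)) (p.getVert (i + j + 1)) ≤ 1 := by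
      rcases Nat.lt_or_ge (i + j) p.length with h | h
      · exact (dist_eq_one_iff_adj.2 (p.adj_getVert_succ h)).le
      · rw [p.getVert_of_length_le h, p.getVert_of_length_le (h.trans (Nat.le_succ _))]
        simp
    exact hT.dist_triangle.trans (Nat.add_le_add ih h)

/-- In a tree, a vertex has at most one neighbour closer to a given base vertex. -/
theorem IsTree.eq_of_adj_of_dist_eq_add_one (hT : T.IsTree) {o a b c : V} (hb : T.Adj b a)
    (hc : T.Adj c a) (hdb : T.dist o a = T.dist o b + 1) (hdc : T.dist o a = T.dist o c + 1) :
    b = c := by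
  obtain ⟨p, hp⟩ := hT.connected.exists_walk_length_eq_dist o b
  obtain ⟨q, hq⟩ := hT.connected.exists_walk_length_eq_dist o c
  have hp' : (p.concat hb).IsPath := Walk.isPath_of_length_eq_dist _ (by simp [hp, hdb])
  have hq' : (q.concat hc).IsPath := Walk.isPath_of_length_eq_dist _ (by simp [hq, hdc])
  have h := (hT.existsUnique_path o a).unique hp' hq'
  have := congrArg Walk.penultimate h
  simpa using this

/-- Geodesics in a tree are extended by edges that do not turn back. -/
theorem IsTree.dist_eq_add_one_of_ne (hT : T.IsTree) {o a b c : V} (hb : T.Adj b a)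
    (hc : T.Adj a c) (hbc : b ≠ c) (hd : T.dist o a = T.dist o b + 1) :
    T.dist o c = T.dist o a + 1 := by
  rcases hT.dist_eq_dist_add_one_of_adj o hc with h | h
  · exact absurd (hT.eq_of_adj_of_dist_eq_add_one hb hc.symm hd h) hbc
  · exact h

/-- A walk without backtracking in a tree is a geodesic. -/
theorem IsTree.dist_eq_of_nonbacktracking (hT : T.IsTree) (c : ℕ → V)
    (hadj : ∀ i, T.Adj (c i) (c (i + 1))) (hne : ∀ i, c i ≠ c (i + 2)) (n : ℕ) :
    T.dist (c 0) (c n) = n := by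
  suffices h : T.dist (c 0) (c n) = n ∧ T.dist (c 0) (c (n + 1)) = n + 1 from h.1
  induction n with
  | zero => exact ⟨by simp, by simpa using dist_eq_one_iff_adj.2 (hadj 0)⟩
  | succ n ih =>
    refine ⟨ih.2, ?_⟩
    rw [hT.dist_eq_add_one_of_ne (hadj n) (hadj (n + 1)) (hne n) (by rw [ih.1, ih.2]), ih.2]

/-- Take `v` of least displacement `l`. The translates of the geodesic from `v` to `f v` join
without backtracking: at a joint, a turn would invert an edge if `l = 1`, and lower the displacement
if `l ≥ 2`. -/
theorem IsHyperbolic.exists_dist_pow_apply (hT : T.IsTree) {f : T ≃g T} (hf : IsHyperbolic f) :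
    ∃ (v : V) (l : ℕ), 0 < l ∧ ∀ n : ℕ, T.dist v ((f ^ n) v) = l * n := by
  obtain ⟨hinv, hell⟩ := hf
  have := hT.connected.nonempty
  obtain ⟨v, hv⟩ : ∃ v, ∀ w, T.dist v (f v) ≤ T.dist w (f w) :=
    ⟨_, fun w => Function.argmin_le (fun w => T.dist w (f w)) w⟩
  have hl : 0 < T.dist v (f v) :=
    hT.connected.pos_dist_of_ne fun h => hell ⟨v, h.symm⟩
  obtain ⟨p, hp⟩ := hT.connected.exists_walk_length_eq_dist v (f v)
  set l := T.dist v (f v) with hl_def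
  have hpath := p.isPath_of_length_eq_dist hp
  set c : ℕ → V := fun i => (f ^ (i / l)) (p.getVert (i % l)) with hc
  -- Allowing `r = l` covers the joints, where two translates meet.
  have hcl : ∀ n r, r ≤ l → c (l * n + r) = (f ^ n) (p.getVert r) := by
    intro n r hr
    rcases hr.lt_or_eq with h | rfl
    · simp [hc, Nat.mul_add_div hl, Nat.div_eq_of_lt h, Nat.mod_eq_of_lt h]
    · have h1 : (l * n + l) / l = n + 1 := by
        rw [← Nat.mul_succ, Nat.mul_div_cancel_left _ hl]
      have h2 : p.getVert l = f v := by rw [← hp, Walk.getVert_length]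
      simp [hc, h1, h2, pow_succ]
  refine ⟨v, l, hl, fun n => ?_⟩
  have h0 : c 0 = v := by simp [hc]
  have hn : c (l * n) = (f ^ n) v := by simpa using hcl n 0 (Nat.zero_le _)
  have hdec : ∀ i, ∃ n r, r < l ∧ i = l * n + r := fun i =>
    ⟨i / l, i % l, Nat.mod_lt _ hl, (Nat.div_add_mod i l).symm⟩
  rw [← hn]
  nth_rewrite 1 [← h0]
  refine hT.dist_eq_of_nonbacktracking c (fun i => ?_) (fun i => ?_) _
  · obtain ⟨n, r, hr, rfl⟩ := hdec i
    rw [add_assoc, hcl n r hr.le, hcl n (r + 1) hr]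
    exact (f ^ n).map_adj_iff.2 (p.adj_getVert_succ (hp ▸ hr))
  · obtain ⟨n, r, hr, rfl⟩ := hdec i
    rcases Nat.lt_or_ge (r + 1) l with h | h
    · rw [add_assoc, hcl n r hr.le, hcl n (r + 2) h]
      intro he
      have := hpath.getVert_injOn (by simp; omega) (by simp; omega) ((f ^ n).injective he)
      omega
    · have hr1 : l = r + 1 := by omega
      have e : l * n + r + 2 = l * (n + 1) + 1 := by rw [Nat.mul_succ]; omega
      rw [e, hcl n r hr.le, hcl (n + 1) 1 hl, pow_succ]
      intro he
      have he : p.getVert r = f (p.getVert 1) := (f ^ n).injective he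
      rcases Nat.eq_zero_or_pos r with rfl | hr0
      · have h2 : p.getVert 1 = f v := by rw [← Nat.zero_add 1, ← hr1, ← hp, Walk.getVert_length]
        refine hinv ⟨v, f v, dist_eq_one_iff_adj.1 hr1, rfl, ?_⟩
        rw [← h2, ← he, Walk.getVert_zero]
      · have h1 := hv (p.getVert 1)
        rw [← he] at h1
        have h2 := p.dist_getVert_le hT.connected 1 (r - 1)
        rw [show 1 + (r - 1) = r by omega] at h2
        omega

theorem IsHyperbolic.exists_mul_le_dist (hT : T.IsTree) {f : T ≃g T} (hf : IsHyperbolic f) (v : V) :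
    ∃ C : ℕ, ∀ n : ℕ, n ≤ C + T.dist v ((f ^ n) v) := by
  obtain ⟨a, l, hl, h⟩ := hf.exists_dist_pow_apply hT
  refine ⟨2 * T.dist a v, fun n => ?_⟩
  have h1 := hT.connected.dist_triangle (u := a) (v := v) (w := (f ^ n) a)
  have h2 := hT.connected.dist_triangle (u := v) (v := (f ^ n) v) (w := (f ^ n) a)
  rw [Iso.dist_apply hT.connected, dist_comm (u := v) (v := a)] at h2
  have := Nat.le_mul_of_pos_left n hl
  rw [← h n] at this
  omega

theorem dist_pow_apply_le (hT : T.Connected) (f : T ≃g T) (v : V) (n : ℕ) :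
    T.dist v ((f ^ n) v) ≤ n * T.dist v (f v) := by
  induction n with
  | zero => simp
  | succ n ih =>
    have h := hT.dist_triangle (u := v) (v := (f ^ n) v) (w := (f ^ n) (f v))
    rw [Iso.dist_apply hT] at h
    rw [pow_succ, RelIso.mul_apply, Nat.succ_mul]
    omega

theorem exists_sq_apply_eq_of_not_isHyperbolic {f : T ≃g T} (hf : ¬ IsHyperbolic f) :
    ∃ v, (f ^ 2) v = v := by
  by_cases h : IsInversion f
  · obtain ⟨a, b, -, hab, hba⟩ := h
    exact ⟨a, by rw [pow_two, RelIso.mul_apply, hab, hba]⟩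
  · obtain ⟨a, ha⟩ : IsElliptic f := by_contra fun h' => hf ⟨h, h'⟩
    exact ⟨a, by rw [pow_two, RelIso.mul_apply, ha, ha]⟩

/-- No positive power of a hyperbolic automorphism of a tree has roots of all orders. -/
theorem IsHyperbolic.exists_not_isRoot (hT : T.IsTree) {f : T ≃g T} (hf : IsHyperbolic f)
    {N : ℕ} (hN : 0 < N) : ∃ k : ℕ, 0 < k ∧ ∀ h : T ≃g T, h ^ k ≠ f ^ N := by
  obtain ⟨v⟩ := hT.connected.nonempty
  -- A hyperbolic `h` has growth rate at least 1, so `h ^ k` has rate at least `k`, while `f ^ N`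
  -- has rate at most `k - 1`.
  refine ⟨N * T.dist v (f v) + 1, Nat.succ_pos _, fun h hh => ?_⟩
  set k := N * T.dist v (f v) + 1 with hk
  by_cases hhyp : IsHyperbolic h
  · obtain ⟨C, hC⟩ := hhyp.exists_mul_le_dist hT v
    have h1 := hC (k * (C + 1))
    have h2 := dist_pow_apply_le hT.connected f v (N * (C + 1))
    rw [pow_mul, hh, ← pow_mul] at h1
    have h3 := h1.trans (Nat.add_le_add_left h2 C)
    rw [hk] at h3
    nlinarith
  · obtain ⟨a, ha⟩ := exists_sq_apply_eq_of_not_isHyperbolic hhyp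
    obtain ⟨C, hC⟩ := hf.exists_mul_le_dist hT a
    have h1 := dist_pow_apply_le hT.connected (h ^ 2) a (k * (C + 1))
    rw [ha, dist_self, ← pow_mul, mul_left_comm, ← mul_assoc, mul_assoc, pow_mul, hh, ← pow_mul] at h1
    have h2 := hC (N * (2 * (C + 1)))
    have := Nat.le_mul_of_pos_left (2 * (C + 1)) hN
    omega

end SimpleGraph

/-! ### Types and the descending chain condition -/

open FirstOrder.Language in
/-- A sequence of formulas with finitely satisfiable initial segments is contained in a complete
type. -/
theorem FirstOrder.Language.exists_completeType_forall_mem {L : FirstOrder.Language.{u, v}}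
    {M : Type w} [L.Structure M] [Nonempty M] {α : Type*} (φ : ℕ → L.Formula α)
    (hφ : ∀ n, ∃ a : α → M, ∀ m ≤ n, (φ m).Realize a) :
    ∃ p : (L.completeTheory M).CompleteType α, ∀ n, Formula.equivSentence (φ n) ∈ p := by
  have hsat : ((L.lhomWithConstants α).onTheory (L.completeTheory M) ∪
      Set.range fun n => Formula.equivSentence (φ n)).IsSatisfiable := by
    have hU : (L.lhomWithConstants α).onTheory (L.completeTheory M) ∪
        (Set.range fun n => Formula.equivSentence (φ n)) =
        ⋃ n : ℕ, ((L.lhomWithConstants α).onTheory (L.completeTheory M) ∪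
          (fun m => Formula.equivSentence (φ m)) '' Set.Iic n) := by
      rw [← Set.union_iUnion, ← Set.image_iUnion, Set.iUnion_Iic, Set.image_univ]
    rw [hU, Theory.isSatisfiable_directed_union_iff]
    · intro n
      obtain ⟨a, ha⟩ := hφ n
      refine Theory.IsSatisfiable.mono ((L.completeTheory M).typeOf a).isMaximal.1
        (Set.union_subset (Theory.CompleteType.subset _) ?_)
      rintro _ ⟨m, hm, rfl⟩
      exact Theory.CompleteType.formula_mem_typeOf.2 (ha m hm)
    · exact Monotone.directed_le fun i j hij =>
        Set.union_subset_union_right _ (Set.image_mono (Set.Iic_subset_Iic.2 hij))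
  by_contra! h
  refine (Theory.CompleteType.setOfPred_subset_eq_empty_iff _).1 ?_ hsat
  refine Set.eq_empty_of_forall_notMem fun p hp => ?_
  obtain ⟨n, hn⟩ := h p
  exact hn (hp ⟨n, rfl⟩)

open FirstOrder.Language in
/-- Two formulas in a common complete type are realized together. -/
theorem FirstOrder.Language.exists_realize_of_mem_completeType {L : FirstOrder.Language.{u, v}}
    {M : Type w} [L.Structure M] [Nonempty M] {α : Type*} [Finite α]
    (p : (L.completeTheory M).CompleteType α) {φ ψ : L.Formula α} (hφ : Formula.equivSentence φ ∈ p)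
    (hψ : Formula.equivSentence ψ ∈ p) : ∃ a : α → M, φ.Realize a ∧ ψ.Realize a := by
  obtain ⟨N, a, rfl⟩ := Theory.exists_modelType_is_realized_in _ p
  rw [Theory.CompleteType.formula_mem_typeOf] at hφ hψ
  have h : N ⊨ ((φ ⊓ ψ).relabel (Sum.inr : α → Empty ⊕ α)).iExs α := by
    simp only [Sentence.Realize, Formula.realize_iExs, Formula.realize_relabel,
      Formula.realize_inf, Sum.elim_comp_inr]
    exact ⟨a, hφ, hψ⟩
  rw [realize_iff_of_model_completeTheory M N] at h
  simpa only [Sentence.Realize, Formula.realize_iExs, Formula.realize_relabel,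
      Formula.realize_inf, Sum.elim_comp_inr] using h

open FirstOrder.Language in
/-- In an `ω`-stable group, subgroups definable over a countable set satisfy the descending chain
condition. -/
theorem FirstOrder.Language.IsOmegaStable.wellFounded_definable_subgroup
    {L : FirstOrder.Language.{u, v}} {G : Type w} [Group G] [L.Structure G]
    (hG : L.IsOmegaStable G) {A : Set G} (hA : A.Countable)
    (hmul : A.DefinableFun L fun p : Fin 2 → G => p 0 * p 1) :
    WellFounded fun H K : {H : Subgroup G // A.Definable₁ L (H : Set G)} => H < K := by
  rw [RelEmbedding.wellFounded_iff_isEmpty]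
  refine ⟨fun e => ?_⟩
  have hlt : ∀ n, (e (n + 1)).1 < (e n).1 := fun n => e.map_rel_iff.2 (Nat.lt_succ_self n)
  -- The cosets of `1` and `a n` modulo the next subgroup are disjoint, so a descending chain yields
  -- a binary tree of cosets and a type for each branch.
  choose a ha ha' using fun n => SetLike.exists_of_lt (hlt n)
  -- the coset representatives along a branch
  let c : (ℕ → Bool) → ℕ → G := fun σ n =>
    Nat.rec 1 (fun i g => g * if σ i then a i else 1) n
  have c_succ : ∀ σ n, c σ (n + 1) = c σ n * if σ n then a n else 1 := fun _ _ => rfl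
  have hmono : Antitone fun n => (e n).1 := antitone_nat_of_succ_le fun n => (hlt n).le
  have c_le : ∀ σ m n, m ≤ n → (c σ m)⁻¹ * c σ n ∈ (e m).1 := by
    intro σ m n hmn
    induction n, hmn using Nat.le_induction with
    | base => simp
    | succ n hmn ih =>
      rw [c_succ, ← mul_assoc]
      refine mul_mem ih (hmono hmn ?_)
      split_ifs
      exacts [ha n, one_mem _]
  have c_congr : ∀ σ τ : ℕ → Bool, ∀ n, (∀ i < n, σ i = τ i) → c σ n = c τ n := by
    intro σ τ n h
    induction n with
    | zero => rfl
    | succ n ih =>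
      rw [c_succ, c_succ, ih fun i hi => h i (hi.trans n.lt_succ_self), h n n.lt_succ_self]
  -- Countable, since `c σ n` depends only on the first `n` values of `σ`.
  let B : Set G := A ∪ ⋃ n, Set.range fun σ => (c σ n)⁻¹
  have hB : B.Countable := by
    refine hA.union (Set.countable_iUnion fun n => ?_)
    refine Set.Finite.countable ((Set.finite_range fun t : Fin n → Bool =>
      (c (fun i => if h : i < n then t ⟨i, h⟩ else false) n)⁻¹).subset ?_)
    rintro _ ⟨σ, rfl⟩
    exact ⟨fun i => σ i, congrArg _ (c_congr _ _ _ fun i hi => by simp [hi])⟩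
  have hcB : ∀ σ n, (c σ n)⁻¹ ∈ B := fun σ n => Or.inr (Set.mem_iUnion.2 ⟨n, σ, rfl⟩)
  have hdef : ∀ σ n, B.Definable L {v : Fin 1 → G | (c σ n)⁻¹ * v 0 ∈ (e n).1} := by
    intro σ n
    have hF : B.DefinableFun L fun v : Fin 1 → G => (c σ n)⁻¹ * v 0 := by
      refine Set.DefinableFun.comp (g := fun v : Fin 1 → G => ![(c σ n)⁻¹, v 0]) ?_
        (hmul.mono Set.subset_union_left)
      intro i
      fin_cases i
      · exact definableFun_const L _ (hcB σ n)
      · exact Set.DefinableFun.proj L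
    exact Set.Definable.preimage_map (F := fun v : Fin 1 → G => ![(c σ n)⁻¹ * v 0])
      (fun i => by fin_cases i; exact hF) ((e n).2.mono Set.subset_union_left)
  choose φ hφ using hdef
  have hreal : ∀ σ n (v : Fin 1 → G), (φ σ n).Realize v ↔ (c σ n)⁻¹ * v 0 ∈ (e n).1 :=
    fun σ n v => (Set.ext_iff.1 (hφ σ n) v).symm
  have := hG G rfl B hB
  choose p hp using fun σ => exists_completeType_forall_mem (φ σ) fun n =>
    ⟨fun _ => c σ n, fun m hm => (hreal _ _ _).2 (c_le σ m n hm)⟩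
  have hsep : ∀ σ τ n, (∀ i < n, σ i = τ i) → σ n = true → τ n = false → p σ ≠ p τ := by
    intro σ τ n h hσ hτ hpq
    obtain ⟨v, hv1, hv2⟩ := exists_realize_of_mem_completeType (p σ) (hp σ (n + 1))
      (hpq ▸ hp τ (n + 1))
    rw [hreal, c_succ, hσ] at hv1
    rw [hreal, c_succ, hτ, ← c_congr σ τ n h] at hv2
    refine ha' n ?_
    have := mul_mem hv2 (inv_mem hv1)
    simpa [mul_assoc] using this
  have hinj : Function.Injective p := by
    intro σ τ hpq
    by_contra hne
    classical
    have hex : ∃ n, σ n ≠ τ n := Function.ne_iff.1 hne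
    have hmin : ∀ i < Nat.find hex, σ i = τ i := fun i hi => not_not.1 (Nat.find_min hex hi)
    have hspec := Nat.find_spec hex
    cases hσ : σ (Nat.find hex) <;> cases hτ : τ (Nat.find hex)
    · exact hspec (hσ.trans hτ.symm)
    · exact hsep τ σ _ (fun i hi => (hmin i hi).symm) hτ hσ hpq.symm
    · exact hsep σ τ _ hmin hσ hτ hpq
    · exact hspec (hσ.trans hτ.symm)
  have hcount : Countable (ℕ → Bool) := hinj.countable
  rw [← Cardinal.mk_le_aleph0_iff] at hcount
  simpa using hcount.trans_lt (Cardinal.cantor _)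

/-! ### Definable subgroups and roots -/

section

variable {L : FirstOrder.Language.{u, v}} {G : Type w} [Group G] [L.Structure G] {A : Set G}
  {α : Type*}

theorem Set.definableFun_mul (hmul : A.DefinableFun L fun p : Fin 2 → G => p 0 * p 1)
    {f f' : (α → G) → G} (hf : A.DefinableFun L f) (hf' : A.DefinableFun L f') :
    A.DefinableFun L fun v => f v * f' v :=
  Set.DefinableFun.comp (g := fun v => ![f v, f' v])
    (fun i => by fin_cases i <;> assumption) hmul

theorem Set.definableFun_pow_succ (hmul : A.DefinableFun L fun p : Fin 2 → G => p 0 * p 1)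
    {f : (α → G) → G} (hf : A.DefinableFun L f) (n : ℕ) :
    A.DefinableFun L fun v => f v ^ (n + 1) := by
  induction n with
  | zero => simpa using hf
  | succ n ih =>
    simp_rw [_root_.pow_succ _ (n + 1)]
    exact Set.definableFun_mul hmul ih hf

theorem Set.definable₁_centralizer
    (hmul : A.DefinableFun L fun p : Fin 2 → G => p 0 * p 1) {S : Set G}
    (hS : A.Definable₁ L S) : A.Definable₁ L S.centralizer := by
  have h1 : A.Definable L {v : Fin 1 ⊕ Fin 1 → G | v (.inr 0) ∈ S} :=
    hS.preimage_comp Sum.inr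
  have h2 : A.Definable L {v : Fin 1 ⊕ Fin 1 → G | v (.inr 0) * v (.inl 0) =
      v (.inl 0) * v (.inr 0)} :=
    Set.DefinableFun.ofPred_eq (Set.definableFun_mul hmul (.proj L) (.proj L))
      (Set.definableFun_mul hmul (.proj L) (.proj L))
  refine Eq.mp ?_ (h1.himp h2).forall_of_finite
  unfold Set.Definable₁
  congr 1
  ext v
  simp [Set.mem_centralizer_iff, himp_eq, Fin.forall_fin_succ_pi, imp_iff_or_not]

theorem Set.definable₁_image_pow_succ
    (hmul : A.DefinableFun L fun p : Fin 2 → G => p 0 * p 1) {S : Set G}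
    (hS : A.Definable₁ L S) (n : ℕ) : A.Definable₁ L ((· ^ (n + 1)) '' S) := by
  have h1 : A.Definable L {v : Fin 1 ⊕ Fin 1 → G | v (.inr 0) ∈ S} :=
    hS.preimage_comp Sum.inr
  have h2 : A.Definable L {v : Fin 1 ⊕ Fin 1 → G | v (.inr 0) ^ (n + 1) = v (.inl 0)} :=
    Set.DefinableFun.ofPred_eq (Set.definableFun_pow_succ hmul (.proj L) n) (.proj L)
  refine Eq.mp ?_ (h1.inter h2).exists_of_finite
  unfold Set.Definable₁
  congr 1
  ext v
  simp [Fin.exists_fin_succ_pi]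

/-- Some positive power of any given element of an `ω`-stable group has roots of all orders. -/
theorem FirstOrder.Language.IsOmegaStable.exists_forall_isRoot (hG : L.IsOmegaStable G)
    (hmul : (Set.univ : Set G).Definable L {p : Fin 3 → G | p 0 * p 1 = p 2}) (g : G) :
    ∃ N : ℕ, 0 < N ∧ ∀ k : ℕ, 0 < k → ∃ h : G, h ^ k = g ^ N := by
  obtain ⟨A₀, -, hA₀⟩ := Set.definable_iff_finitely_definable.1 hmul
  set A : Set G := insert g A₀
  have hA : A.Countable := A₀.countable_toSet.insert g
  have hmul' : A.DefinableFun L fun p : Fin 2 → G => p 0 * p 1 :=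
    (hA₀.mono (Set.subset_insert _ _)).preimage_comp ![some 0, some 1, none]
  -- The double centralizer is definable, contains `g` and is abelian, so its `n`-th powers form a
  -- subgroup.
  set Z : Subgroup G := Subgroup.centralizer (Subgroup.centralizer {g} : Set G)
  have hZ : A.Definable₁ L (Z : Set G) :=
    Set.definable₁_centralizer hmul'
      (Set.definable₁_centralizer hmul' (Set.Definable.singleton_of_mem L (Set.mem_insert _ _)))
  have hgC : g ∈ Subgroup.centralizer {g} := by simp [Subgroup.mem_centralizer_singleton_iff]
  have hgZ : g ∈ Z := fun y hy => (hy g rfl).symm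
  have hcomm : ∀ x ∈ Z, ∀ y ∈ Z, Commute x y := fun x hx y hy =>
    hy x fun z hz => by rw [Set.mem_singleton_iff.1 hz]; exact hx g hgC
  let D (n : ℕ) : Subgroup G :=
    { carrier := (· ^ n) '' (Z : Set G)
      one_mem' := ⟨1, one_mem Z, one_pow n⟩
      mul_mem' := by
        rintro _ _ ⟨x, hx, rfl⟩ ⟨y, hy, rfl⟩
        exact ⟨x * y, mul_mem hx hy, (hcomm x hx y hy).mul_pow n⟩
      inv_mem' := by
        rintro _ ⟨x, hx, rfl⟩
        exact ⟨x⁻¹, inv_mem hx, inv_pow x n⟩ }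
  have hD : ∀ n, A.Definable₁ L (D (n + 1) : Set G) :=
    Set.definable₁_image_pow_succ hmul' hZ
  have hD_le : ∀ n k, D (n * k) ≤ D n := by
    rintro n k _ ⟨x, hx, rfl⟩
    exact ⟨x ^ k, pow_mem hx k, by simp only [← pow_mul, mul_comm]⟩
  -- The shift to `n + 1` excludes the trivial group `D 0`, which would give `N = 0`.
  obtain ⟨_, ⟨n, rfl⟩, hn⟩ := (hG.wellFounded_definable_subgroup hA hmul').has_min
    (Set.range fun n : ℕ => ⟨D (n + 1), hD n⟩) ⟨_, 0, rfl⟩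
  refine ⟨n + 1, n.succ_pos, fun k hk => ?_⟩
  obtain ⟨m, hm⟩ : ∃ m, (n + 1) * k = m + 1 :=
    Nat.exists_eq_succ_of_ne_zero (Nat.mul_pos n.succ_pos hk).ne'
  have hge : D (m + 1) ≤ D (n + 1) := hm ▸ hD_le (n + 1) k
  have hle : D (n + 1) ≤ D (m + 1) := by
    by_contra h
    exact hn _ ⟨m, rfl⟩ (lt_of_le_not_ge hge h)
  obtain ⟨y, -, hy⟩ := hle ⟨g, hgZ, rfl⟩
  exact ⟨y ^ (n + 1), by rw [← pow_mul, hm]; exact hy⟩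

end

/-- Every action of an `ω`-stable group on a simplicial tree is trivial. The group may carry
structure beyond the group operation: it is an `ω`-stable structure in some countable language `L`
in which the multiplication is definable. The language of groups is the basic case. -/
theorem theorem1 (L : FirstOrder.Language.{u, v}) [Countable L.Symbols]
    (G : Type w) [Group G] [L.Structure G]
    (hmul : (Set.univ : Set G).Definable L {p : Fin 3 → G | p 0 * p 1 = p 2})
    (hG : L.IsOmegaStable G)
    (V : Type x) (T : SimpleGraph V) (hT : T.IsTree) (ρ : G →* (T ≃g T)) :
    SimpleGraph.IsTrivialAction ρ := by
  intro g hg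
  obtain ⟨N, hN, hroot⟩ := hG.exists_forall_isRoot hmul g
  obtain ⟨k, hk, hno⟩ := hg.exists_not_isRoot hT hN
  obtain ⟨h, hh⟩ := hroot k hk
  exact hno (ρ h) (by rw [← map_pow, hh, map_pow])
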